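/- For $0<\alpha<\tfrac12$ let $C_\alpha\subset[0,1]$ be the middle-$(1-2\alpha)$ Cantor set, i.e. $C_\alpha=\bigcap_{k\ge 0}E_k$ with $E_0=[0,1]$ and $E_{k+1}=\alpha E_k\cup(1-\alpha+\alpha E_k)$. A Pisot number is a real algebraic integer $\omega>1$ all of whose other Galois conjugates (the other complex roots of its minimal polynomial over $\mathbb{Q}$) have absolute value less than $1$. Let $\mathcal{P}$ be the set of all pairs $(C_\alpha,C_\beta)$ with $\alpha=\omega^{-n}<\tfrac12$ and $\beta=\omega^{-m}<\tfrac12$ for some Pisot number $\omega$ and some $n,m\in\mathbb{N}$. **Corollary P.** Let $(C_\alpha,C_\beta)\in\mathcal{P}$, and let $\omega$ be any Pisot number with $\alpha=\omega^{-n}$, $\beta=\omega^{-m}$ for some $n,m\in\mathbb{N}$. Then $F=\mathbb{Q}[\omega]$ is a dense subfield of $\mathbb{R}$ and, for every $\mu\in F$, the set $C_\alpha-\mu C_\beta=\{x-\mu y: x\in C_\alpha,\ y\in C_\beta\}$ either contains an interval of positive length or has Lebesgue measure zero. -/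

import Mathlib

open MeasureTheory
open scoped Pointwise

/-- A Pisot number: a real algebraic integer greater than `1` all of whose other Galois conjugates
(the other complex roots of its minimal polynomial) have absolute value less than `1`. -/
def IsPisot (ω : ℝ) : Prop :=
  1 < ω ∧ IsIntegral ℤ ω ∧
    ∀ z : ℂ, Polynomial.aeval z (minpoly ℚ ω) = 0 → z ≠ (ω : ℂ) → ‖z‖ < 1

/-- The `n`-th step of the construction of the middle Cantor set with ratio `α`: the step `0` is
`[0, 1]`, and the step `n + 1` is the union of the images of the step `n` under
`x ↦ α x` and `x ↦ 1 - α + α x`. -/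
noncomputable def preMiddleCantor (α : ℝ) : ℕ → Set ℝ
  | 0 => Set.Icc 0 1
  | n + 1 => (fun x => α * x) '' preMiddleCantor α n ∪
      (fun x => 1 - α + α * x) '' preMiddleCantor α n

/-- The middle-`(1 - 2α)` Cantor set `C_α` (meant for `0 < α < 1 / 2`), with convex hull `[0, 1]`:
the intersection of all the steps of the construction. -/
noncomputable def middleCantor (α : ℝ) : Set ℝ := ⋂ n, preMiddleCantor α n

/-- The set contains a nondegenerate interval. -/
def ContainsInterval (A : Set ℝ) : Prop := ∃ a b : ℝ, a < b ∧ Set.Icc a b ⊆ A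

/-!
Put `N = n * m` and `Ω = ω ^ N`. Both Cantor sets are, after iterating their own contraction,
covered by finitely many translates by elements of `ℚ(ω)` of their image under `x ↦ Ω⁻¹ x`. Hence
`K = C_α - μ C_β` is compact and `Ω K ⊆ D + K` for a finite set of digits `D ⊆ ℚ(ω)`. Iterating,
every point of `Ω ^ k K` lies in `x + K` for some expansion `x = ∑ j < k, Ω ^ j d j` with digits in
`D`.

The Pisot property enters through Garsia's separation argument
(`IsPisot.finite_bounded_expansions`): the differences of such expansions become algebraic integers
of `ℚ(ω)` after multiplication by a fixed integer, and all their conjugates other than themselves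
are bounded by a geometric series. So only finitely many of these differences, over all `k`, lie in
a bounded interval. It follows that there is one finite set `T` such that, in any window of a fixed
size, every `Ω ^ k K` is contained in a translate of `T + K`.

If `K` has empty interior, so does the closed set `T + K`, and compactness gives a lower bound,
independent of `k`, for the length of some gap of `Ω ^ k K` near any of its points
(`exists_uniform_gap`). Scaling back, `K` has at every point and every scale `Ω⁻ᵏ` a gap of
comparable size, so that Lebesgue's density theorem forces `K` to be null
(`volume_eq_zero_of_porous`).
-/

open Set Filter Topology Metric IntermediateField

/-! ### Porous sets are null -/

/-- A set having, at each of its points and at each scale `Ω⁻ᵏ`, a hole of comparable size is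
Lebesgue null: it has no density point. -/
theorem volume_eq_zero_of_porous {S : Set ℝ} {Ω δ : ℝ} (hΩ : 1 < Ω) (hδ : 0 < δ)
    (h : ∀ x ∈ S, ∀ k : ℕ, ∃ w, |x - w| ≤ (Ω ^ k)⁻¹ ∧
      S ∩ closedBall w (δ * (Ω ^ k)⁻¹) = ∅) (hS : MeasurableSet S) : volume S = 0 := by
  have key := IsUnifLocDoublingMeasure.ae_tendsto_measure_inter_div (volume : Measure ℝ) S δ⁻¹
  rw [ae_restrict_iff' hS] at key
  refine measure_mono_null (t := {x | ¬ _}) ?_ key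
  intro x hx hdens
  choose w hw hgap using h x hx
  have hpos : ∀ k : ℕ, 0 < δ * (Ω ^ k)⁻¹ := fun k => by positivity
  have hlim : Tendsto (fun k : ℕ => δ * (Ω ^ k)⁻¹) atTop (𝓝[>] 0) := by
    refine tendsto_nhdsWithin_iff.2 ⟨?_, Eventually.of_forall hpos⟩
    simpa using (tendsto_inv_atTop_zero.comp (tendsto_pow_atTop_atTop_of_one_lt hΩ)).const_mul δ
  have hone := hdens hx w _ hlim (Eventually.of_forall fun k => by
    rw [mem_closedBall, Real.dist_eq, inv_mul_cancel_left₀ hδ.ne']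
    exact hw k)
  simp only [hgap, measure_empty, ENNReal.zero_div] at hone
  exact zero_ne_one (tendsto_nhds_unique tendsto_const_nhds hone)

/-! ### Gaps in finite unions of translates -/

theorem interior_finite_add_eq_empty {T K : Set ℝ} (hT : T.Finite) (hK : IsClosed K)
    (hint : interior K = ∅) : interior (T + K) = ∅ := by
  induction T, hT using Set.Finite.induction_on with
  | empty => simp
  | @insert a T _ _ ih =>
    rw [insert_eq, union_add, singleton_add, image_add_left,
      interior_union_isClosed_of_interior_empty (hK.preimage (by fun_prop)) ih]
    have := (Homeomorph.addLeft (-a)).preimage_interior K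
    simpa [hint] using this.symm

/-- A closed set with empty interior has gaps of uniform size near all points of a compact set. -/
theorem exists_uniform_gap {L C : Set ℝ} (hL : IsClosed L) (hint : interior L = ∅)
    (hC : IsCompact C) :
    ∃ δ > 0, ∀ u ∈ C, ∃ w, |u - w| ≤ 1 ∧ L ∩ closedBall w δ = ∅ := by
  refine hC.induction_on (p := fun s => ∃ δ > 0, ∀ u ∈ s, ∃ w, |u - w| ≤ 1 ∧
    L ∩ closedBall w δ = ∅) ⟨1, one_pos, by simp⟩ ?_ ?_ ?_
  · rintro s t hst ⟨δ, hδ, h⟩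
    exact ⟨δ, hδ, fun u hu => h u (hst hu)⟩
  · rintro s t ⟨δ, hδ, h⟩ ⟨ε, hε, h'⟩
    refine ⟨min δ ε, lt_min hδ hε, ?_⟩
    rintro u (hu | hu)
    · obtain ⟨w, hw, hd⟩ := h u hu
      exact ⟨w, hw, subset_empty_iff.1 (hd ▸ inter_subset_inter_right _
        (closedBall_subset_closedBall (min_le_left _ _)))⟩
    · obtain ⟨w, hw, hd⟩ := h' u hu
      exact ⟨w, hw, subset_empty_iff.1 (hd ▸ inter_subset_inter_right _
        (closedBall_subset_closedBall (min_le_right _ _)))⟩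
  · intro u _
    have hd : Dense Lᶜ := interior_eq_empty_iff_dense_compl.1 hint
    obtain ⟨w, hwL, hw⟩ := hd.exists_dist_lt u (by norm_num : (0 : ℝ) < 1 / 2)
    obtain ⟨δ, hδ, hball⟩ := nhds_basis_closedBall.mem_iff.1 (hL.isOpen_compl.mem_nhds hwL)
    refine ⟨ball u (1 / 2), mem_nhdsWithin_of_mem_nhds (ball_mem_nhds _ (by norm_num)), δ, hδ,
      fun v hv => ⟨w, ?_, ?_⟩⟩
    · rw [← Real.dist_eq]
      rw [mem_ball] at hv
      linarith [dist_triangle v u w]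
    · exact (disjoint_compl_right.mono_right hball).inter_eq

/-! ### Expansions with finitely many digits -/

/-- If `Ω K ⊆ D + K` then the points of `Ω ^ k K` are within `K` of an expansion of length `k`. -/
theorem exists_expansion {K D : Set ℝ} {Ω : ℝ} (h : ∀ x ∈ K, ∃ d ∈ D, ∃ y ∈ K, Ω * x = d + y)
    (k : ℕ) {x : ℝ} (hx : x ∈ K) :
    ∃ e : ℕ → ℝ, (∀ j, e j ∈ D) ∧ ∃ y ∈ K, Ω ^ k * x = ∑ j ∈ Finset.range k, Ω ^ j * e j + y := by
  induction k with
  | zero =>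
    obtain ⟨d, hd, -⟩ := h x hx
    exact ⟨fun _ => d, fun _ => hd, x, hx, by simp⟩
  | succ k ih =>
    obtain ⟨e, he, y, hy, hxy⟩ := ih
    obtain ⟨d, hd, z, hz, hyz⟩ := h y hy
    refine ⟨fun j => Nat.casesOn j d e, fun j => by cases j <;> simp [hd, he], z, hz, ?_⟩
    rw [Finset.sum_range_succ', pow_succ', mul_assoc, hxy, mul_add, hyz, Finset.mul_sum]
    simp only [pow_succ', mul_assoc, pow_zero, one_mul]
    exact (add_assoc _ _ _).symm

/-- A compact set with `Ω K ⊆ D + K`, for which the differences of expansions with digits in `D`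
form a locally finite set, is null as soon as its interior is empty. -/
theorem volume_eq_zero_of_interior_eq_empty {K D : Set ℝ} {Ω : ℝ} (hΩ : 1 < Ω) (hK : IsCompact K)
    (h : ∀ x ∈ K, ∃ d ∈ D, ∃ y ∈ K, Ω * x = d + y)
    (hfin : ∀ R : ℝ, {y : ℝ | |y| ≤ R ∧ ∃ (k : ℕ) (e : ℕ → ℝ), (∀ j, e j ∈ D - D) ∧
      y = ∑ j ∈ Finset.range k, Ω ^ j * e j}.Finite)
    (hint : interior K = ∅) : volume K = 0 := by
  obtain ⟨r, hr⟩ := hK.isBounded.exists_norm_le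
  simp only [Real.norm_eq_abs] at hr
  -- Translates `x + K` and `x₀ + K` that meet a window of radius `2` have `|x - x₀| ≤ 2 * (r + 2)`.
  set T := {y : ℝ | |y| ≤ 2 * (r + 2) ∧ ∃ (k : ℕ) (e : ℕ → ℝ), (∀ j, e j ∈ D - D) ∧
      y = ∑ j ∈ Finset.range k, Ω ^ j * e j} with hTdef
  have hT : T.Finite := hfin _
  have hL : IsClosed (T + K) := (hT.isCompact.add hK).isClosed
  obtain ⟨δ, hδ, hgap⟩ := exists_uniform_gap hL (interior_finite_add_eq_empty hT hK.isClosed hint)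
    (isCompact_Icc (a := -(r + 2)) (b := r + 2))
  refine volume_eq_zero_of_porous hΩ (lt_min hδ one_pos) ?_ hK.measurableSet
  intro x hx k
  have hpos : 0 < Ω ^ k := by positivity
  -- The reference translate: the one containing the centre `Ω ^ k * x` of the window.
  obtain ⟨e₀, he₀, y₀, hy₀, hxy₀⟩ := exists_expansion h k hx
  obtain ⟨w, hw, hwL⟩ := hgap y₀ (by
    have := abs_le.1 (hr y₀ hy₀)
    constructor <;> linarith)
  set x₀ := ∑ j ∈ Finset.range k, Ω ^ j * e₀ j
  have hscale : ∀ u, |u - (Ω ^ k)⁻¹ * (x₀ + w)| = (Ω ^ k)⁻¹ * |Ω ^ k * u - (x₀ + w)| := by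
    intro u
    rw [← abs_of_pos (inv_pos.2 hpos), ← abs_mul, abs_of_pos (inv_pos.2 hpos), mul_sub,
      inv_mul_cancel_left₀ hpos.ne']
  refine ⟨(Ω ^ k)⁻¹ * (x₀ + w), ?_, ?_⟩
  · rw [hscale, hxy₀, add_sub_add_left_eq_sub]
    exact mul_le_of_le_one_right (inv_pos.2 hpos).le hw
  · rw [eq_empty_iff_forall_notMem]
    rintro u ⟨huK, hu⟩
    rw [mem_closedBall, Real.dist_eq, hscale, mul_comm, mul_le_mul_iff_left₀ (inv_pos.2 hpos)] at hu
    obtain ⟨e, he, y, hy, huy⟩ := exists_expansion h k huK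
    rw [huy] at hu
    have h1 := abs_le.1 (hu.trans (min_le_right _ _))
    have h2 := abs_le.1 (hr y hy)
    have h3 := abs_le.1 (hr y₀ hy₀)
    have h4 := abs_le.1 hw
    have hmem : ∑ j ∈ Finset.range k, Ω ^ j * e j - x₀ ∈ T := by
      refine ⟨abs_le.2 ⟨by linarith, by linarith⟩, k, fun j => e j - e₀ j,
        fun j => Set.sub_mem_sub (he j) (he₀ j), ?_⟩
      rw [← Finset.sum_sub_distrib]
      simp only [mul_sub]
    refine (eq_empty_iff_forall_notMem.1 hwL) _ ⟨Set.add_mem_add hmem hy, ?_⟩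
    rw [mem_closedBall, Real.dist_eq]
    refine le_trans (le_of_eq ?_) (hu.trans (min_le_left _ _))
    congr 1
    ring

/-! ### Separation of expansions in a Pisot base -/

/-- Garsia's separation property: expansions in powers of `ω ^ N` with digits in a finite subset
of `ℚ(ω)` form a locally finite set. -/
theorem IsPisot.finite_bounded_expansions {ω : ℝ} (hω : IsPisot ω) {N : ℕ} (hN : N ≠ 0)
    {E : Set ℝ} (hE : E.Finite) (hEF : E ⊆ ℚ⟮ω⟯) (R : ℝ) :
    {y : ℝ | |y| ≤ R ∧ ∃ (k : ℕ) (e : ℕ → ℝ), (∀ j, e j ∈ E) ∧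
      y = ∑ j ∈ Finset.range k, (ω ^ N) ^ j * e j}.Finite := by
  obtain ⟨-, hint, hconj⟩ := hω
  have hintQ : IsIntegral ℚ ω := hint.tower_top
  have : FiniteDimensional ℚ ℚ⟮ω⟯ := adjoin.finiteDimensional hintQ
  have : NumberField ℚ⟮ω⟯ := ⟨⟩
  set g : ℚ⟮ω⟯ := AdjoinSimple.gen ℚ ω
  set E' : Set ℚ⟮ω⟯ := (↑) ⁻¹' E
  have hE' : E'.Finite := hE.preimage Subtype.val_injective.injOn
  have hgint : IsIntegral ℤ g := by
    rw [← isIntegral_algebraMap_iff (FaithfulSMul.algebraMap_injective ℚ⟮ω⟯ ℝ)]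
    exact hint
  obtain ⟨q, hq, hqE⟩ := exists_integral_multiples ℤ ℚ hE'.toFinset
  simp only [Set.Finite.mem_toFinset] at hqE
  have hbound : ∀ φ : ℚ⟮ω⟯ →+* ℂ, ∃ B : ℝ, ∀ y : ℚ⟮ω⟯, |(y : ℝ)| ≤ R →
      (∃ (k : ℕ) (e : ℕ → ℚ⟮ω⟯), (∀ j, e j ∈ E') ∧
        y = ∑ j ∈ Finset.range k, (g ^ N) ^ j * e j) → ‖φ (q • y)‖ ≤ B := by
    intro φ
    by_cases hφ : φ g = (ω : ℂ)
    · -- Here `φ` is the inclusion, and the bound is that on `y` itself.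
      have hφ' : ∀ y, φ y = ((y : ℝ) : ℂ) := by
        have : φ.toRatAlgHom = ((Complex.ofRealHom.toRatAlgHom).comp ℚ⟮ω⟯.val) := by
          apply adjoin_algHom_ext
          intro x hx
          obtain rfl : x = ω := hx
          exact hφ
        exact fun y => DFunLike.congr_fun this y
      refine ⟨|(q : ℝ)| * R, fun y hy _ => ?_⟩
      rw [map_zsmul, zsmul_eq_mul, norm_mul, hφ', Complex.norm_real, Real.norm_eq_abs,
        Complex.norm_intCast]
      gcongr
    · have hroot : Polynomial.aeval (φ g) (minpoly ℚ ω) = 0 := by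
        have h1 : Polynomial.aeval g (minpoly ℚ ω) = 0 := by
          rw [← minpoly_gen ℚ ω]
          exact minpoly.aeval _ _
        have h2 := Polynomial.aeval_algHom_apply φ.toRatAlgHom g (minpoly ℚ ω)
        rw [h1, map_zero] at h2
        exact h2
      have hlt : ‖φ g‖ < 1 := hconj _ hroot hφ
      have hlt' : ‖φ g‖ ^ N < 1 := pow_lt_one₀ (norm_nonneg _) hlt hN
      obtain ⟨M, hM⟩ := (hE'.image fun x => ‖φ x‖).bddAbove
      refine ⟨|(q : ℝ)| * ((1 - ‖φ g‖ ^ N)⁻¹ * max M 0), ?_⟩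
      rintro y - ⟨k, e, he, rfl⟩
      rw [map_zsmul, zsmul_eq_mul, norm_mul, Complex.norm_intCast]
      refine mul_le_mul_of_nonneg_left ?_ (abs_nonneg _)
      calc ‖φ (∑ j ∈ Finset.range k, (g ^ N) ^ j * e j)‖
          ≤ ∑ j ∈ Finset.range k, (‖φ g‖ ^ N) ^ j * max M 0 := by
            rw [map_sum]
            refine norm_sum_le_of_le _ fun j _ => ?_
            rw [map_mul, map_pow, map_pow, norm_mul, norm_pow, norm_pow]
            gcongr
            exact (hM ⟨_, he j, rfl⟩).trans (le_max_left _ _)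
        _ ≤ (1 - ‖φ g‖ ^ N)⁻¹ * max M 0 := by
            rw [← Finset.sum_mul]
            gcongr
            rw [← tsum_geometric_of_lt_one (by positivity) hlt']
            exact (summable_geometric_of_lt_one (by positivity) hlt').sum_le_tsum _
              fun _ _ => by positivity
  choose B hB using hbound
  obtain ⟨C, hC⟩ := (Set.finite_range B).bddAbove
  have hfin := NumberField.Embeddings.finite_of_norm_le ℚ⟮ω⟯ ℂ C
  have hqinj : Function.Injective fun y : ℚ⟮ω⟯ => q • y := smul_right_injective _ hq
  refine ((hfin.preimage hqinj.injOn).image ((↑) : ℚ⟮ω⟯ → ℝ)).subset ?_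
  rintro y ⟨hy, k, e, he, rfl⟩
  set e' : ℕ → ℚ⟮ω⟯ := fun j => ⟨e j, hEF (he j)⟩
  have hcoe : ((∑ j ∈ Finset.range k, (g ^ N) ^ j * e' j : ℚ⟮ω⟯) : ℝ) =
      ∑ j ∈ Finset.range k, (ω ^ N) ^ j * e j := by
    rw [← IntermediateField.coe_val, map_sum]
    rfl
  refine ⟨_, ⟨?_, fun φ => (hB φ _ (hcoe ▸ hy) ⟨k, e', he, rfl⟩).trans (hC ⟨φ, rfl⟩)⟩, hcoe⟩
  dsimp only
  rw [Finset.smul_sum]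
  refine IsIntegral.sum _ fun j _ => ?_
  rw [← mul_smul_comm]
  exact ((hgint.pow _).pow _).mul (hqE _ (he j))

/-! ### Self-similarity of the Cantor sets -/

theorem isCompact_preMiddleCantor (α : ℝ) (k : ℕ) : IsCompact (preMiddleCantor α k) := by
  induction k with
  | zero => exact isCompact_Icc
  | succ k ih => exact (ih.image (by fun_prop)).union (ih.image (by fun_prop))

theorem isCompact_middleCantor (α : ℝ) : IsCompact (middleCantor α) :=
  (isCompact_preMiddleCantor α 0).of_isClosed_subset
    (isClosed_iInter fun k => (isCompact_preMiddleCantor α k).isClosed) (iInter_subset _ 0)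

theorem preMiddleCantor_subset_Icc {α : ℝ} (h0 : 0 < α) (h1 : α < 1 / 2) (k : ℕ) :
    preMiddleCantor α k ⊆ Icc 0 1 := by
  induction k with
  | zero => exact subset_rfl
  | succ k ih =>
    rintro x (⟨y, hy, rfl⟩ | ⟨y, hy, rfl⟩) <;> obtain ⟨hy0, hy1⟩ := ih hy <;> constructor <;>
      dsimp only <;> nlinarith

theorem exists_eq_of_mem_middleCantor {α x : ℝ} (h0 : 0 < α) (h1 : α < 1 / 2)
    (hx : x ∈ middleCantor α) :
    ∃ d ∈ ({0, 1 - α} : Set ℝ), ∃ y ∈ middleCantor α, x = d + α * y := by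
  rw [middleCantor, mem_iInter] at hx
  -- As `α < 1 / 2`, the two branches are separated by `α`, so that `x` lies in the same branch
  -- at every step.
  rcases le_or_gt x α with hxα | hxα
  · refine ⟨0, by simp, x / α, mem_iInter.2 fun k => ?_, by field_simp; ring⟩
    rcases hx (k + 1) with ⟨y, hy, rfl⟩ | ⟨y, hy, rfl⟩
    · simpa [h0.ne'] using hy
    · have := (preMiddleCantor_subset_Icc h0 h1 k hy).1
      dsimp only at hxα
      nlinarith
  · refine ⟨1 - α, by simp, (x - (1 - α)) / α, mem_iInter.2 fun k => ?_, by field_simp; ring⟩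
    rcases hx (k + 1) with ⟨y, hy, rfl⟩ | ⟨y, hy, rfl⟩
    · have := (preMiddleCantor_subset_Icc h0 h1 k hy).2
      dsimp only at hxα
      nlinarith
    · simpa [h0.ne'] using hy

/-- The Cantor set is covered by finitely many translates of its image under the `k`-th iterate of
its contraction. -/
theorem exists_digits_middleCantor {α : ℝ} (h0 : 0 < α) (h1 : α < 1 / 2) {F : Subfield ℝ}
    (hF : α ∈ F) (k : ℕ) :
    ∃ A : Set ℝ, A.Finite ∧ A ⊆ F ∧
      ∀ x ∈ middleCantor α, ∃ a ∈ A, ∃ y ∈ middleCantor α, x = a + α ^ k * y := by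
  induction k with
  | zero => exact ⟨{0}, by simp, by simp, fun x hx => ⟨0, rfl, x, hx, by simp⟩⟩
  | succ k ih =>
    obtain ⟨A, hA, hAF, h⟩ := ih
    refine ⟨image2 (fun a d => a + α ^ k * d) A {0, 1 - α}, hA.image2 _ (by simp), ?_, ?_⟩
    · rintro _ ⟨a, ha, d, hd, rfl⟩
      refine F.add_mem (hAF ha) (F.mul_mem (F.pow_mem hF k) ?_)
      rcases hd with rfl | rfl
      exacts [F.zero_mem, F.sub_mem F.one_mem hF]
    · intro x hx
      obtain ⟨a, ha, y, hy, rfl⟩ := h x hx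
      obtain ⟨d, hd, z, hz, rfl⟩ := exists_eq_of_mem_middleCantor h0 h1 hy
      exact ⟨_, ⟨a, ha, d, hd, rfl⟩, z, hz, by ring⟩

/-- If powers of `α` and `β` agree, the differences `C_α - μ C_β` are self-similar, with digits in
any field containing `α`, `β` and `μ`. -/
theorem exists_digits_sub_smul {α β μ Ω : ℝ} (hα0 : 0 < α) (hα1 : α < 1 / 2) (hβ0 : 0 < β)
    (hβ1 : β < 1 / 2) {F : Subfield ℝ} (hα : α ∈ F) (hβ : β ∈ F) (hμ : μ ∈ F) {k l : ℕ}
    (hαΩ : α ^ k = Ω⁻¹) (hβΩ : β ^ l = Ω⁻¹) (hΩ : 0 < Ω) :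
    ∃ D : Set ℝ, D.Finite ∧ D ⊆ F ∧ ∀ x ∈ middleCantor α - μ • middleCantor β,
      ∃ d ∈ D, ∃ y ∈ middleCantor α - μ • middleCantor β, Ω * x = d + y := by
  obtain ⟨A, hA, hAF, hAc⟩ := exists_digits_middleCantor hα0 hα1 hα k
  obtain ⟨B, hB, hBF, hBc⟩ := exists_digits_middleCantor hβ0 hβ1 hβ l
  have hΩF : Ω ∈ F := by
    rw [← inv_inv Ω, ← hαΩ]
    exact F.inv_mem (F.pow_mem hα k)
  refine ⟨image2 (fun a b => Ω * (a - μ * b)) A B, hA.image2 _ hB, ?_, ?_⟩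
  · rintro _ ⟨a, ha, b, hb, rfl⟩
    exact F.mul_mem hΩF (F.sub_mem (hAF ha) (F.mul_mem hμ (hBF hb)))
  · rintro _ ⟨x, hx, _, ⟨y, hy, rfl⟩, rfl⟩
    obtain ⟨a, ha, x', hx', rfl⟩ := hAc x hx
    obtain ⟨b, hb, y', hy', rfl⟩ := hBc y hy
    refine ⟨_, ⟨a, ha, b, hb, rfl⟩, x' - μ • y',
      Set.sub_mem_sub hx' (Set.smul_mem_smul_set hy'), ?_⟩
    simp only [smul_eq_mul, hαΩ, hβΩ]
    field_simp
    ring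

theorem corollaryP (ω : ℝ) (hω : IsPisot ω) (n m : ℕ) (α β : ℝ)
    (hα : α = ω ^ (-(n : ℤ))) (hβ : β = ω ^ (-(m : ℤ)))
    (hα_half : α < 1 / 2) (hβ_half : β < 1 / 2) :
    ∃ F : Subfield ℝ,
      (F : Set ℝ) = (Algebra.adjoin ℚ {ω} : Set ℝ) ∧
      Dense (F : Set ℝ) ∧
      ∀ μ ∈ F,
        ContainsInterval (middleCantor α - μ • middleCantor β) ∨
          volume (middleCantor α - μ • middleCantor β) = 0 := by
  have hω0 : 0 < ω := one_pos.trans hω.1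
  have hn : n ≠ 0 := by
    rintro rfl
    norm_num [hα] at hα_half
  have hm : m ≠ 0 := by
    rintro rfl
    norm_num [hβ] at hβ_half
  have hgen : ω ∈ ℚ⟮ω⟯.toSubfield := mem_adjoin_simple_self ℚ ω
  have hintQ : IsIntegral ℚ ω := hω.2.1.tower_top
  refine ⟨ℚ⟮ω⟯.toSubfield, ?_, ?_, ?_⟩
  · rw [← adjoin_simple_toSubalgebra_of_isAlgebraic hintQ.isAlgebraic]
    rfl
  · refine (Rat.denseRange_cast (𝕜 := ℝ)).mono ?_
    rintro _ ⟨q, rfl⟩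
    exact SubfieldClass.ratCast_mem _ q
  · intro μ hμ
    set K := middleCantor α - μ • middleCantor β
    have hK : IsCompact K := by
      rw [show K = middleCantor α + -(μ • middleCantor β) from sub_eq_add_neg _ _]
      exact (isCompact_middleCantor α).add ((isCompact_middleCantor β).smul μ).neg
    have hα0 : 0 < α := hα ▸ zpow_pos hω0 _
    have hβ0 : 0 < β := hβ ▸ zpow_pos hω0 _
    have hαΩ : α ^ m = (ω ^ (n * m))⁻¹ := by
      rw [hα, zpow_neg, zpow_natCast, inv_pow, ← pow_mul]
    have hβΩ : β ^ n = (ω ^ (n * m))⁻¹ := by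
      rw [hβ, zpow_neg, zpow_natCast, inv_pow, ← pow_mul, mul_comm]
    obtain ⟨D, hD, hDF, hDK⟩ := exists_digits_sub_smul hα0 hα_half hβ0 hβ_half
      (hα ▸ zpow_mem hgen _) (hβ ▸ zpow_mem hgen _) hμ hαΩ hβΩ (by positivity)
    have hDD : D - D ⊆ ℚ⟮ω⟯ := by
      rintro _ ⟨a, ha, b, hb, rfl⟩
      exact ℚ⟮ω⟯.sub_mem (hDF ha) (hDF hb)
    rcases (interior K).eq_empty_or_nonempty with hempty | ⟨x, hx⟩
    · exact Or.inr <| volume_eq_zero_of_interior_eq_empty (one_lt_pow₀ hω.1 (mul_ne_zero hn hm)) hK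
        hDK (hω.finite_bounded_expansions (mul_ne_zero hn hm) (hD.sub hD) hDD) hempty
    · left
      obtain ⟨ε, hε, hball⟩ := nhds_basis_closedBall.mem_iff.1 (mem_interior_iff_mem_nhds.1 hx)
      exact ⟨x - ε, x + ε, by linarith, Real.closedBall_eq_Icc ▸ hball⟩
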